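/- Let $\mathcal X$ be a set of datasets with a neighboring relation and let $\mathcal Y$ be a measurable space. For probability measures $P,Q$ on $\mathcal Y$ and $\alpha>1$ let $D_\alpha(P\|Q)=\frac1{\alpha-1}\log \mathbb E_{z\sim P}\big[\big(\tfrac{dP}{dQ}(z)\big)^{\alpha-1}\big]$ if $P\ll Q$, and $D_\alpha(P\|Q)=+\infty$ otherwise. A randomized algorithm $M:\mathcal X\to\mathcal Y$ is *$\delta$-approximately $(\xi,\rho)$-zCDP* if for all neighbors $x,x'$ there are events $E,E'$ (of the probability spaces carrying the random outputs $M(x)$ and $M(x')$) with $\Pr[E],\Pr[E']\ge 1-\delta$ such that, for every $\alpha>1$, $$D_\alpha\big(M(x)|_E\,\|\,M(x')|_{E'}\big)\le \alpha\rho+\xi\quad\text{and}\quad D_\alpha\big(M(x')|_{E'}\,\|\,M(x)|_{E}\big)\le \alpha\rho+\xi ,$$ where $M(x)|_E$ is the law of $M(x)$ conditioned on $E$. Let $\mathcal E=\{(\delta_i,\xi_i,\rho_i): i\in[k]\}$ be a family of parameters with $\delta_i,\rho_i\ge 0$ and $\xi_i\in\mathbb R$. For $b\in\{0,1\}$, *experiment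 $b$* consists of $k$ rounds. In each round a deterministic analyst, depending on the outcomes of the previous rounds, selects an index $j\in[k]$ that was not selected before, a $\delta_j$-approximately $(\xi_j,\rho_j)$-zCDP mechanism $M:\mathcal X\to\mathcal Y$, and neighboring datasets $x^{(0)},x^{(1)}$; the analyst then receives an outcome drawn from $M(x^{(b)})$ with fresh randomness. (The law of this outcome is assumed to depend measurably on the previous outcomes.) Let $V^{(b)}\in\mathcal Y^k$ be the view of the analyst, that is, the sequence of the $k$ outcomes. **Lemma.** For every $\delta>0$ put $$\varepsilon_g=\sum_{i\in[k]}(\xi_i+\rho_i)+2\sqrt{\sum_{i\in[k]}\rho_i\log(1/\delta)}$$ (the square root of a negative number, which can occur only for $\delta>1$, being read as $0$). Then $\mathcal E$ is $(\varepsilon_g,\ \delta+\sum_{i\in[k]}\delta_i)$-differentially private under set-wise adaptive composition: for every such analyst, every $b\in\{0,1\}$ and every measurable $S\subseteq\mathcal Y^k$, $$\Pr[V^{(b)}\in S]\le e^{\varepsilon_g}\Pr[V^{(1-b)}\in S]+\delta+\sum_{i\in[k]}\delta_i .$$ -/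

import Mathlib

open MeasureTheory ProbabilityTheory

universe u v

noncomputable section

namespace SetwiseComposition

open scoped Classical in
/-- The Rényi divergence of order `α` (used for `α > 1`),
`D_α(P ‖ Q) = (α - 1)⁻¹ log E_{z ∼ P} [(dP/dQ (z)) ^ (α - 1)]`,
with value `+∞` when `P` is not absolutely continuous with respect to `Q`. -/
def renyiDiv {Y : Type v} [MeasurableSpace Y] (α : ℝ) (P Q : Measure Y) : EReal :=
  if P ≪ Q then
    (((α - 1)⁻¹ : ℝ) : EReal) * ENNReal.log (∫⁻ z, (P.rnDeriv Q z) ^ (α - 1) ∂P)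
  else ⊤

/-- A randomized output with law `ν`, realised as a random variable `Z` on some probability space
`(Ω, P)` (the coins of the algorithm), together with an event `E` of that probability space. The
event may depend on all the randomness in `Ω`, not only on the value of the output. -/
structure OutputWithEvent {Y : Type v} [MeasurableSpace Y] (ν : Measure Y) where
  Ω : Type v
  mΩ : MeasurableSpace Ω
  P : Measure Ω
  isProbabilityMeasure : IsProbabilityMeasure P
  Z : Ω → Y
  measurable_Z : Measurable Z
  map_Z : P.map Z = ν
  E : Set Ω
  measurableSet_E : MeasurableSet E

attribute [instance] OutputWithEvent.mΩ OutputWithEvent.isProbabilityMeasure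

/-- The probability `Pr[E]` of the event. -/
def OutputWithEvent.prob {Y : Type v} [MeasurableSpace Y] {ν : Measure Y}
    (R : OutputWithEvent ν) : ℝ :=
  R.P.real R.E

/-- The law of the output conditioned on the event `E`. -/
def OutputWithEvent.condLaw {Y : Type v} [MeasurableSpace Y] {ν : Measure Y}
    (R : OutputWithEvent ν) : Measure Y :=
  (ProbabilityTheory.cond R.P R.E).map R.Z

/-- A triple `(δ, ξ, ρ)` of approximate zCDP parameters. -/
structure ZCDPParam where
  δ : ℝ
  ξ : ℝ
  ρ : ℝ

/-- The randomized algorithm `M : X → Y`, given by the law `M x` of its output on each input `x`,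
is `δ`-approximately `(ξ, ρ)`-zCDP with respect to the neighboring relation `Neighbor`. -/
def IsApproxZCDP {X : Type u} {Y : Type v} [MeasurableSpace Y] (Neighbor : X → X → Prop)
    (p : ZCDPParam) (M : X → ProbabilityMeasure Y) : Prop :=
  ∀ x x' : X, Neighbor x x' →
    ∃ (R : OutputWithEvent (M x : Measure Y)) (R' : OutputWithEvent (M x' : Measure Y)),
      1 - p.δ ≤ R.prob ∧ 1 - p.δ ≤ R'.prob ∧
        ∀ α : ℝ, 1 < α →
          renyiDiv α R.condLaw R'.condLaw ≤ ((α * p.ρ + p.ξ : ℝ) : EReal) ∧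
          renyiDiv α R'.condLaw R.condLaw ≤ ((α * p.ρ + p.ξ : ℝ) : EReal)

/-- A (deterministic, adaptive) analyst in the set-wise adaptive composition experiment with the
parameters `𝓔 i`, `i ∈ [k]`. In round `i`, having seen the outcomes `h : Fin i → Y` of the
previous rounds, the analyst selects the parameters with index `index i h`, which were not
selected in an earlier round, a mechanism `mech i h` satisfying approximate zCDP with the selected
parameters, and two neighboring datasets `data i h false` and `data i h true`. -/
structure Analyst {X : Type u} (Neighbor : X → X → Prop) (Y : Type v) [MeasurableSpace Y]
    {k : ℕ} (𝓔 : Fin k → ZCDPParam) where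
  index : (i : Fin k) → (Fin i → Y) → Fin k
  mech : (i : Fin k) → (Fin i → Y) → X → ProbabilityMeasure Y
  data : (i : Fin k) → (Fin i → Y) → Bool → X
  index_ne : ∀ (i j : Fin k) (hji : j < i) (h : Fin i → Y),
    index j (fun l => h (Fin.castLE hji.le l)) ≠ index i h
  mech_zCDP : ∀ (i : Fin k) (h : Fin i → Y), IsApproxZCDP Neighbor (𝓔 (index i h)) (mech i h)
  neighbor : ∀ (i : Fin k) (h : Fin i → Y), Neighbor (data i h false) (data i h true)
  /-- The law of the outcome of round `i` is a measurable function of the previous outcomes. -/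
  measurable_law : ∀ (i : Fin k) (b : Bool),
    Measurable fun h : Fin i → Y => (mech i h (data i h b) : Measure Y)

namespace Analyst

variable {X : Type u} {Neighbor : X → X → Prop} {Y : Type v} [MeasurableSpace Y]
  {k : ℕ} {𝓔 : Fin k → ZCDPParam}

/-- The conditional law of the outcome of round `i` in experiment `b`, given the previous
outcomes. -/
def outcomeKernel (A : Analyst Neighbor Y 𝓔) (b : Bool) (i : Fin k) :
    Kernel (Fin i → Y) Y where
  toFun h := (A.mech i h (A.data i h b) : Measure Y)
  measurable' := A.measurable_law i b

/-- The joint law of the outcomes of the first `n` rounds in experiment `b`. -/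
def viewUpTo (A : Analyst Neighbor Y 𝓔) (b : Bool) : (n : ℕ) → n ≤ k → Measure (Fin n → Y)
  | 0, _ => Measure.dirac Fin.elim0
  | n + 1, hn =>
      ((A.viewUpTo b n (Nat.le_of_succ_le hn)).compProd (A.outcomeKernel b ⟨n, hn⟩)).map
        fun p : (Fin n → Y) × Y => (Fin.snoc p.1 p.2 : Fin (n + 1) → Y)

/-- The law of the view `V^{(b)}` of the analyst in experiment `b`. As the analyst is
deterministic, the view consists of the outcomes of the `k` rounds, which determine all the
selections of the analyst. -/
def view (A : Analyst Neighbor Y 𝓔) (b : Bool) : Measure (Fin k → Y) :=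
  A.viewUpTo b k le_rfl

instance isMarkovKernel_outcomeKernel (A : Analyst Neighbor Y 𝓔) (b : Bool) (i : Fin k) :
    IsMarkovKernel (A.outcomeKernel b i) :=
  ⟨fun h => inferInstanceAs (IsProbabilityMeasure (A.mech i h (A.data i h b) : Measure Y))⟩

theorem measurable_snoc (n : ℕ) :
    Measurable fun p : (Fin n → Y) × Y => (Fin.snoc p.1 p.2 : Fin (n + 1) → Y) := by
  refine measurable_pi_lambda _ fun i => ?_
  refine Fin.lastCases ?_ (fun j => ?_) i
  · simpa using measurable_snd
  · simpa [Function.comp_def] using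
      (measurable_pi_apply (X := fun _ : Fin n => Y) j).comp
        (measurable_fst (α := Fin n → Y) (β := Y))

theorem isProbabilityMeasure_viewUpTo (A : Analyst Neighbor Y 𝓔) (b : Bool) (n : ℕ)
    (hn : n ≤ k) : IsProbabilityMeasure (A.viewUpTo b n hn) := by
  induction n with
  | zero => exact inferInstanceAs (IsProbabilityMeasure (Measure.dirac _))
  | succ n ih =>
    have := ih (Nat.le_of_succ_le hn)
    let κ : Kernel (Fin n → Y) Y := A.outcomeKernel b ⟨n, hn⟩
    have hκ : IsMarkovKernel κ := A.isMarkovKernel_outcomeKernel b ⟨n, hn⟩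
    have : IsProbabilityMeasure ((A.viewUpTo b n (Nat.le_of_succ_le hn)).compProd κ) :=
      inferInstance
    exact Measure.isProbabilityMeasure_map (measurable_snoc n).aemeasurable

instance isProbabilityMeasure_view (A : Analyst Neighbor Y 𝓔) (b : Bool) :
    IsProbabilityMeasure (A.view b) :=
  A.isProbabilityMeasure_viewUpTo b k le_rfl

end Analyst

/-- `𝓔` is `(ε, δ)`-differentially private under set-wise adaptive composition, where approximate
zCDP mechanisms (with inputs in `X` and outcomes in `Y`) are selected at each round. -/
def IsSetwiseAdaptiveDP {X : Type u} (Neighbor : X → X → Prop) (Y : Type v) [MeasurableSpace Y]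
    {k : ℕ} (𝓔 : Fin k → ZCDPParam) (ε δ : ℝ) : Prop :=
  ∀ (A : Analyst Neighbor Y 𝓔) (b : Bool) (S : Set (Fin k → Y)), MeasurableSet S →
    (A.view b).real S ≤ Real.exp ε * (A.view (!b)).real S + δ

end SetwiseComposition

end

namespace SetwiseComposition

open scoped ENNReal

/-! Fix one order `α > 1` for all rounds and put `θ = (α - 1) / α`. Hölder turns a Rényi bound `c`
into `E_P[g ^ θ] ≤ exp (θ c) (E_Q g) ^ θ`. A domination `f ≤ C g ^ θ + d` is therefore stable under
averaging over one round (`lintegral_le_of_le_mul_rpow_add`): `C` gains a factor `exp (θ c)` and `d`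
gains `δ_j`. Going backwards from `f = g = 1_S`, the constants at a history are the product and the
sum over the indices not yet selected. Each round moves one index into them, so at the empty history
they run over all of `[k]`, whatever the analyst's strategy (`lintegral_viewUpTo_le`). Young's
inequality then linearises the power, and a suitable `α` makes the error at most `δ`. -/

/-- A bound on the Rényi divergence is absolute continuity together with a bound on the moment of
the density. -/
theorem lintegral_rnDeriv_rpow_le_of_renyiDiv_le {Y : Type v} [MeasurableSpace Y] {α c : ℝ}
    (hα : 1 < α) {P Q : Measure Y} (h : renyiDiv α P Q ≤ (c : EReal)) :
    P ≪ Q ∧ ∫⁻ z, (P.rnDeriv Q z) ^ (α - 1) ∂P ≤ ENNReal.ofReal (Real.exp ((α - 1) * c)) := by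
  have hα' : 0 < α - 1 := sub_pos.2 hα
  unfold renyiDiv at h
  split_ifs at h with hac
  · refine ⟨hac, ?_⟩
    set I := ∫⁻ z, (P.rnDeriv Q z) ^ (α - 1) ∂P
    have h2 : ENNReal.log I ≤ (((α - 1) * c : ℝ) : EReal) := by
      induction hI : ENNReal.log I with
      | bot => exact bot_le
      | top =>
        rw [hI, EReal.coe_mul_top_of_pos (inv_pos.2 hα')] at h
        exact absurd h (by simp)
      | coe x =>
        rw [hI, ← EReal.coe_mul, EReal.coe_le_coe_iff] at h
        rw [EReal.coe_le_coe_iff]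
        rwa [inv_mul_le_iff₀ hα'] at h
    have h3 := EReal.exp_le_exp_iff.2 h2
    rwa [ENNReal.exp_log, EReal.exp_coe] at h3
  · exact absurd h (by simp)

/-- Change of measure by Hölder's inequality. -/
theorem lintegral_rpow_le_of_renyiDiv_le {Y : Type v} [MeasurableSpace Y] {α c : ℝ}
    (hα : 1 < α) {P Q : Measure Y} [IsFiniteMeasure P] [IsFiniteMeasure Q]
    (h : renyiDiv α P Q ≤ (c : EReal)) {g : Y → ℝ≥0∞} (hg : Measurable g) :
    ∫⁻ y, g y ^ ((α - 1) / α) ∂P ≤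
      ENNReal.ofReal (Real.exp ((α - 1) / α * c)) * (∫⁻ y, g y ∂Q) ^ ((α - 1) / α) := by
  obtain ⟨hac, hI⟩ := lintegral_rnDeriv_rpow_le_of_renyiDiv_le hα h
  have hα0 : 0 < α := one_pos.trans hα
  have hα1 : 0 < α - 1 := sub_pos.2 hα
  have hr : Measurable (P.rnDeriv Q) := Measure.measurable_rnDeriv P Q
  have hP : ∀ {f : Y → ℝ≥0∞}, Measurable f → ∫⁻ y, f y ∂P = ∫⁻ y, P.rnDeriv Q y * f y ∂Q := by
    intro f hf
    exact (lintegral_rnDeriv_mul hac hf.aemeasurable).symm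
  -- One density factor is absorbed by the change of measure, giving the `L^α(Q)` norm that Hölder
  -- needs.
  have hmom : ∫⁻ z, (P.rnDeriv Q z) ^ (α - 1) ∂P = ∫⁻ z, (P.rnDeriv Q z) ^ α ∂Q := by
    rw [hP (hr.pow_const _)]
    refine lintegral_congr fun z => ?_
    conv_lhs => rw [← ENNReal.rpow_one (P.rnDeriv Q z), ← ENNReal.rpow_mul, one_mul,
      ← ENNReal.rpow_add_of_nonneg _ _ zero_le_one hα1.le]
    congr 1
    ring
  have hconj : α.HolderConjugate (α / (α - 1)) := Real.HolderConjugate.conjExponent hα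
  have hhol := ENNReal.lintegral_mul_le_Lp_mul_Lq Q hconj hr.aemeasurable
    (hg.pow_const ((α - 1) / α)).aemeasurable
  rw [hP (hg.pow_const _)]
  refine hhol.trans ?_
  rw [← hmom]
  have hpow : ∀ y, (g y ^ ((α - 1) / α)) ^ (α / (α - 1)) = g y := fun y => by
    rw [← ENNReal.rpow_mul, div_mul_div_cancel₀ hα0.ne', div_self hα1.ne', ENNReal.rpow_one]
  simp only [hpow, one_div_div]
  gcongr
  calc (∫⁻ z, (P.rnDeriv Q z) ^ (α - 1) ∂P) ^ (1 / α)
      ≤ (ENNReal.ofReal (Real.exp ((α - 1) * c))) ^ (1 / α) := by gcongr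
    _ = ENNReal.ofReal (Real.exp ((α - 1) / α * c)) := by
      rw [ENNReal.ofReal_rpow_of_pos (Real.exp_pos _), ← Real.exp_mul]
      congr 2
      ring

/-! ### Conditioning on events of probability at least `1 - δ` -/

namespace OutputWithEvent

variable {Y : Type v} [MeasurableSpace Y] {ν : Measure Y} (R : OutputWithEvent ν)

instance isFiniteMeasure_condLaw : IsFiniteMeasure R.condLaw := by
  unfold condLaw
  infer_instance

theorem condLaw_univ_le_one : R.condLaw Set.univ ≤ 1 := by
  rw [condLaw, Measure.map_apply R.measurable_Z MeasurableSet.univ]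
  exact prob_le_one

theorem condLaw_univ_of_prob_pos (h : 0 < R.prob) : R.condLaw Set.univ = 1 := by
  have hE : R.P R.E ≠ 0 := fun h0 => h.ne' (by simp [prob, Measure.real, h0])
  have := cond_isProbabilityMeasure hE
  rw [condLaw, Measure.map_apply R.measurable_Z MeasurableSet.univ, Set.preimage_univ,
    measure_univ]

/-- Multiplying the conditional law by the probability of `E` gives the law of the output restricted
to `E`. -/
theorem smul_condLaw_le {c : ℝ} (hc : c ≤ R.prob) : ENNReal.ofReal c • R.condLaw ≤ ν := by
  refine Measure.le_iff.2 fun S hS => ?_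
  have hmap : ν S = R.P (R.Z ⁻¹' S) := by
    conv_lhs => rw [← R.map_Z, Measure.map_apply R.measurable_Z hS]
  have hc' : ENNReal.ofReal c ≤ R.P R.E :=
    (ENNReal.ofReal_le_ofReal hc).trans (ENNReal.ofReal_toReal_le)
  rw [Measure.smul_apply, smul_eq_mul, condLaw, Measure.map_apply R.measurable_Z hS, hmap]
  calc ENNReal.ofReal c * (ProbabilityTheory.cond R.P R.E) (R.Z ⁻¹' S)
      ≤ (ProbabilityTheory.cond R.P R.E) (R.Z ⁻¹' S) * R.P R.E := by
        rw [mul_comm]; gcongr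
    _ = R.P (R.E ∩ R.Z ⁻¹' S) := cond_mul_eq_inter R.measurableSet_E _ _
    _ ≤ R.P (R.Z ⁻¹' S) := measure_mono Set.inter_subset_right

/-- A function bounded by `1` loses at most `δ` when its expectation is restricted to an event of
probability `1 - δ`. -/
theorem lintegral_le_mul_lintegral_condLaw_add [IsProbabilityMeasure ν] {δ : ℝ}
    (hδ1 : δ < 1) (h : 1 - δ ≤ R.prob) {f : Y → ℝ≥0∞} (hf : ∀ y, f y ≤ 1) :
    ∫⁻ y, f y ∂ν ≤ ENNReal.ofReal (1 - δ) * ∫⁻ y, f y ∂(R.condLaw) + ENNReal.ofReal δ := by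
  have hpos : 0 < 1 - δ := sub_pos.2 hδ1
  have hle := R.smul_condLaw_le h
  set μ := ENNReal.ofReal (1 - δ) • R.condLaw with hμ
  have : IsFiniteMeasure μ := isFiniteMeasure_of_le ν hle
  have hμ1 : μ Set.univ = ENNReal.ofReal (1 - δ) := by
    rw [hμ, Measure.smul_apply, R.condLaw_univ_of_prob_pos (hpos.trans_le h), smul_eq_mul, mul_one]
  -- The part of `ν` not covered by the scaled conditional law has mass exactly `δ`.
  have hrest : (ν - μ) Set.univ = ENNReal.ofReal δ := by
    rw [Measure.sub_apply MeasurableSet.univ hle, hμ1, measure_univ, ← ENNReal.ofReal_one,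
      ← ENNReal.ofReal_sub _ hpos.le, sub_sub_cancel]
  calc ∫⁻ y, f y ∂ν = ∫⁻ y, f y ∂(ν - μ + μ) := by rw [Measure.sub_add_cancel_of_le hle]
    _ = ∫⁻ y, f y ∂(ν - μ) + ENNReal.ofReal (1 - δ) * ∫⁻ y, f y ∂(R.condLaw) := by
      rw [lintegral_add_measure, hμ, lintegral_smul_measure, smul_eq_mul]
    _ ≤ ENNReal.ofReal δ + ENNReal.ofReal (1 - δ) * ∫⁻ y, f y ∂(R.condLaw) := by
      gcongr
      calc ∫⁻ y, f y ∂(ν - μ) ≤ ∫⁻ _, 1 ∂(ν - μ) := lintegral_mono hf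
        _ = ENNReal.ofReal δ := by rw [lintegral_one, hrest]
    _ = _ := add_comm _ _

end OutputWithEvent

/-- The effect of one round: a domination `f ≤ C g ^ θ + d`, where `θ = (α - 1) / α`, is preserved
by taking expectations with respect to the two laws of the outcome, up to the factor
`exp (θ c)` and the additive error `δ`. -/
theorem lintegral_le_of_le_mul_rpow_add {Y : Type v} [MeasurableSpace Y] {ν ν' : Measure Y}
    [IsProbabilityMeasure ν] (R : OutputWithEvent ν) (R' : OutputWithEvent ν')
    {α c δ : ℝ} (hα : 1 < α) (hδ0 : 0 ≤ δ) (hδ1 : δ < 1)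
    (hR : 1 - δ ≤ R.prob) (hR' : 1 - δ ≤ R'.prob)
    (hdiv : renyiDiv α R.condLaw R'.condLaw ≤ (c : EReal))
    {f g : Y → ℝ≥0∞} (hg : Measurable g) (hf : ∀ y, f y ≤ 1) {C d : ℝ≥0∞}
    (hfg : ∀ y, f y ≤ C * g y ^ ((α - 1) / α) + d) :
    ∫⁻ y, f y ∂ν ≤
      ENNReal.ofReal (Real.exp ((α - 1) / α * c)) * C * (∫⁻ y, g y ∂ν') ^ ((α - 1) / α) +
        (ENNReal.ofReal δ + d) := by
  have hα0 : 0 < α := one_pos.trans hα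
  set θ := (α - 1) / α with hθ
  have hθ0 : 0 ≤ θ := div_nonneg (sub_pos.2 hα).le hα0.le
  have hθ1 : θ ≤ 1 := (div_le_one hα0).2 (sub_le_self α zero_le_one)
  set s := ENNReal.ofReal (1 - δ) with hs
  have hs1 : s ≤ 1 := ENNReal.ofReal_le_one.2 (by linarith)
  -- The factor `s` gained from conditioning on `E` pays, inside the power `θ ≤ 1`, for the loss
  -- from conditioning on `E'`; hence no factor `1 / (1 - δ)` appears.
  have hsθ : s ≤ s ^ θ := by
    simpa using ENNReal.rpow_le_rpow_of_exponent_ge hs1 hθ1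
  have hgθ : Measurable fun y => C * g y ^ θ := (hg.pow_const θ).const_mul C
  have hint : ∫⁻ y, f y ∂(R.condLaw) ≤ C * ∫⁻ y, g y ^ θ ∂(R.condLaw) + d := by
    calc ∫⁻ y, f y ∂(R.condLaw) ≤ ∫⁻ y, (C * g y ^ θ + d) ∂(R.condLaw) := lintegral_mono hfg
      _ = C * ∫⁻ y, g y ^ θ ∂(R.condLaw) + d * R.condLaw Set.univ := by
        rw [lintegral_add_left hgθ, lintegral_const_mul _ (hg.pow_const θ), lintegral_const]
      _ ≤ C * ∫⁻ y, g y ^ θ ∂(R.condLaw) + d * 1 := by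
        gcongr
        exact R.condLaw_univ_le_one
      _ = _ := by rw [mul_one]
  have hg' : s * ∫⁻ y, g y ∂(R'.condLaw) ≤ ∫⁻ y, g y ∂ν' := by
    rw [← smul_eq_mul, ← lintegral_smul_measure]
    exact lintegral_mono' (R'.smul_condLaw_le hR') le_rfl
  set K := ENNReal.ofReal (Real.exp (θ * c))
  have hkey : s * ∫⁻ y, g y ^ θ ∂(R.condLaw) ≤ K * (∫⁻ y, g y ∂ν') ^ θ := by
    calc s * ∫⁻ y, g y ^ θ ∂(R.condLaw)
        ≤ s ^ θ * (K * (∫⁻ y, g y ∂(R'.condLaw)) ^ θ) := by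
          gcongr
          exact lintegral_rpow_le_of_renyiDiv_le hα hdiv hg
      _ = K * (s * ∫⁻ y, g y ∂(R'.condLaw)) ^ θ := by
          rw [ENNReal.mul_rpow_of_nonneg _ _ hθ0]; ring
      _ ≤ K * (∫⁻ y, g y ∂ν') ^ θ := by gcongr
  calc ∫⁻ y, f y ∂ν ≤ s * ∫⁻ y, f y ∂(R.condLaw) + ENNReal.ofReal δ :=
        R.lintegral_le_mul_lintegral_condLaw_add hδ1 hR hf
    _ ≤ s * (C * ∫⁻ y, g y ^ θ ∂(R.condLaw) + d) + ENNReal.ofReal δ := by gcongr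
    _ = C * (s * ∫⁻ y, g y ^ θ ∂(R.condLaw)) + s * d + ENNReal.ofReal δ := by ring
    _ ≤ C * (K * (∫⁻ y, g y ∂ν') ^ θ) + 1 * d + ENNReal.ofReal δ := by gcongr
    _ = _ := by ring

/-! ### Backward induction over the adaptive rounds -/

namespace Analyst

variable {X : Type u} {Neighbor : X → X → Prop} {Y : Type v} [MeasurableSpace Y]
  {k : ℕ} {𝓔 : Fin k → ZCDPParam}

/-- The indices that are not selected in the first `n` rounds. -/
def remaining (A : Analyst Neighbor Y 𝓔) (n : ℕ) (hn : n ≤ k) (h : Fin n → Y) :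
    Finset (Fin k) :=
  Finset.univ.filter fun j => ∀ i : Fin n,
    A.index (Fin.castLE hn i) (fun l : Fin i => h (Fin.castLE i.isLt.le l)) ≠ j

theorem remaining_zero (A : Analyst Neighbor Y 𝓔) (h : Fin 0 → Y) :
    A.remaining 0 (Nat.zero_le k) h = Finset.univ := by
  simp [remaining]

theorem index_mem_remaining (A : Analyst Neighbor Y 𝓔) {n : ℕ} (hn : n < k) (h : Fin n → Y) :
    A.index ⟨n, hn⟩ h ∈ A.remaining n hn.le h := by
  simp only [remaining, Finset.mem_filter, Finset.mem_univ, true_and]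
  intro i
  exact A.index_ne ⟨n, hn⟩ (Fin.castLE hn.le i) i.isLt h

theorem remaining_snoc (A : Analyst Neighbor Y 𝓔) {n : ℕ} (hn : n < k) (h : Fin n → Y) (y : Y) :
    A.remaining (n + 1) hn (Fin.snoc h y : Fin (n + 1) → Y) =
      (A.remaining n hn.le h).erase (A.index ⟨n, hn⟩ h) := by
  have hcast : ∀ (m : ℕ) (hm : m ≤ n),
      (fun l : Fin m => (Fin.snoc h y : Fin (n + 1) → Y) (Fin.castLE (hm.trans n.le_succ) l)) =
        fun l => h (Fin.castLE hm l) := fun m hm => by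
    funext l
    exact Fin.snoc_castSucc (α := fun _ => Y) y h (Fin.castLE hm l)
  ext j
  simp only [remaining, Finset.mem_filter, Finset.mem_univ, true_and, Finset.mem_erase]
  rw [Fin.forall_fin_succ', and_comm]
  refine and_congr ?_ (forall_congr' fun i => ?_)
  · have := hcast n le_rfl
    rw [ne_comm]
    exact iff_of_eq (congrArg (fun h' => j ≠ A.index ⟨n, hn⟩ h') this)
  · exact iff_of_eq (congrArg (fun h' => A.index (Fin.castLE hn.le i) h' ≠ j)
      (hcast i i.isLt.le))

/-- The `k` selections are distinct, so they exhaust `Fin k`. -/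
theorem remaining_eq_empty (A : Analyst Neighbor Y 𝓔) (h : Fin k → Y) :
    A.remaining k le_rfl h = ∅ := by
  have hinj : Function.Injective fun i : Fin k =>
      A.index i (fun l : Fin i => h (Fin.castLE i.isLt.le l)) := by
    intro i j hij
    by_contra hne
    rcases lt_or_gt_of_ne hne with hlt | hlt
    · exact A.index_ne j i hlt (fun l => h (Fin.castLE j.isLt.le l)) hij
    · exact A.index_ne i j hlt (fun l => h (Fin.castLE i.isLt.le l)) hij.symm
  refine Finset.eq_empty_of_forall_notMem fun j hj => ?_
  obtain ⟨i, hi⟩ := (Finite.injective_iff_surjective.1 hinj) j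
  exact (Finset.mem_filter.1 hj).2 i hi

/-- Both directions of the divergence bound are part of approximate zCDP, so `b = true` needs no
symmetry of `Neighbor`. -/
theorem exists_outputWithEvent (A : Analyst Neighbor Y 𝓔) (b : Bool) (i : Fin k)
    (h : Fin i → Y) :
    ∃ (R : OutputWithEvent (A.outcomeKernel b i h)) (R' : OutputWithEvent (A.outcomeKernel (!b) i h)),
      1 - (𝓔 (A.index i h)).δ ≤ R.prob ∧ 1 - (𝓔 (A.index i h)).δ ≤ R'.prob ∧
        ∀ α : ℝ, 1 < α → renyiDiv α R.condLaw R'.condLaw ≤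
          ((α * (𝓔 (A.index i h)).ρ + (𝓔 (A.index i h)).ξ : ℝ) : EReal) := by
  obtain ⟨R, R', hR, hR', hdiv⟩ := A.mech_zCDP i h _ _ (A.neighbor i h)
  cases b
  · exact ⟨R, R', hR, hR', fun α hα => (hdiv α hα).1⟩
  · exact ⟨R', R, hR', hR, fun α hα => (hdiv α hα).2⟩

theorem lintegral_viewUpTo_succ (A : Analyst Neighbor Y 𝓔) (b : Bool) {n : ℕ} (hn : n < k)
    {f : (Fin (n + 1) → Y) → ℝ≥0∞} (hf : Measurable f) :
    ∫⁻ h, f h ∂A.viewUpTo b (n + 1) hn =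
      ∫⁻ h, ∫⁻ y, f (Fin.snoc h y : Fin (n + 1) → Y) ∂A.outcomeKernel b ⟨n, hn⟩ h
        ∂A.viewUpTo b n hn.le := by
  have := A.isProbabilityMeasure_viewUpTo b n hn.le
  let κ : Kernel (Fin n → Y) Y := A.outcomeKernel b ⟨n, hn⟩
  have hκ : IsMarkovKernel κ := A.isMarkovKernel_outcomeKernel b ⟨n, hn⟩
  change ∫⁻ h, f h ∂(((A.viewUpTo b n hn.le).compProd κ).map _) = _
  rw [lintegral_map hf (measurable_snoc n)]
  exact Measure.lintegral_compProd (hf.comp (measurable_snoc n))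

theorem measurable_lintegral_snoc (A : Analyst Neighbor Y 𝓔) (b : Bool) {n : ℕ} (hn : n < k)
    {f : (Fin (n + 1) → Y) → ℝ≥0∞} (hf : Measurable f) :
    Measurable fun h : Fin n → Y =>
      ∫⁻ y, f (Fin.snoc h y : Fin (n + 1) → Y) ∂A.outcomeKernel b ⟨n, hn⟩ h := by
  let κ : Kernel (Fin n → Y) Y := A.outcomeKernel b ⟨n, hn⟩
  have hκ : IsMarkovKernel κ := A.isMarkovKernel_outcomeKernel b ⟨n, hn⟩
  exact Measurable.lintegral_kernel_prod_right' (κ := κ) (hf.comp (measurable_snoc n))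

/-- Composition: a domination of functions of the first `n` outcomes whose constants account for
the parameters that remain is turned into a domination of expectations whose constants account for
all parameters. -/
theorem lintegral_viewUpTo_le (A : Analyst Neighbor Y 𝓔) (hδ0 : ∀ i, 0 ≤ (𝓔 i).δ)
    (hδ1 : ∀ i, (𝓔 i).δ < 1) (b : Bool) {α : ℝ} (hα : 1 < α) (n : ℕ) (hn : n ≤ k)
    {f g : (Fin n → Y) → ℝ≥0∞} (hf : Measurable f) (hg : Measurable g) (hf1 : ∀ h, f h ≤ 1)
    (hfg : ∀ h, f h ≤
      (∏ j ∈ A.remaining n hn h,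
        ENNReal.ofReal (Real.exp ((α - 1) / α * (α * (𝓔 j).ρ + (𝓔 j).ξ)))) *
          g h ^ ((α - 1) / α) + ∑ j ∈ A.remaining n hn h, ENNReal.ofReal (𝓔 j).δ) :
    ∫⁻ h, f h ∂A.viewUpTo b n hn ≤
      (∏ j, ENNReal.ofReal (Real.exp ((α - 1) / α * (α * (𝓔 j).ρ + (𝓔 j).ξ)))) *
          (∫⁻ h, g h ∂A.viewUpTo (!b) n hn) ^ ((α - 1) / α) +
        ∑ j, ENNReal.ofReal (𝓔 j).δ := by
  induction n with
  | zero =>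
    have := hfg Fin.elim0
    rw [remaining_zero] at this
    simpa only [viewUpTo, lintegral_dirac' _ hf, lintegral_dirac' _ hg] using this
  | succ n ih =>
    rw [A.lintegral_viewUpTo_succ b hn hf, A.lintegral_viewUpTo_succ (!b) hn hg]
    have hprob : ∀ h : Fin n → Y, IsProbabilityMeasure (A.outcomeKernel b ⟨n, hn⟩ h) :=
      fun h => (A.isMarkovKernel_outcomeKernel b ⟨n, hn⟩).isProbabilityMeasure h
    refine ih (Nat.le_of_succ_le hn) (A.measurable_lintegral_snoc b hn hf)
      (A.measurable_lintegral_snoc (!b) hn hg) (fun h => ?_) (fun h => ?_)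
    · have := hprob h
      calc ∫⁻ y, f (Fin.snoc h y : Fin (n + 1) → Y) ∂A.outcomeKernel b ⟨n, hn⟩ h
          ≤ ∫⁻ _, 1 ∂A.outcomeKernel b ⟨n, hn⟩ h := lintegral_mono fun y => hf1 _
        _ = 1 := by rw [lintegral_one, measure_univ]
    · have := hprob h
      obtain ⟨R, R', hR, hR', hdiv⟩ := A.exists_outputWithEvent b ⟨n, hn⟩ h
      have hmem := A.index_mem_remaining hn h
      -- The selected index is split off; what is left belongs to the history extended by `y`.
      rw [← Finset.mul_prod_erase _ _ hmem, ← Finset.add_sum_erase _ _ hmem]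
      refine lintegral_le_of_le_mul_rpow_add R R' hα (hδ0 _) (hδ1 _) hR hR' (hdiv α hα)
        (hg.comp ((measurable_snoc n).comp measurable_prodMk_left)) (fun y => hf1 _) fun y => ?_
      have := hfg (Fin.snoc h y)
      rwa [A.remaining_snoc hn h y] at this

theorem view_real_le (A : Analyst Neighbor Y 𝓔) (hδ0 : ∀ i, 0 ≤ (𝓔 i).δ)
    (hδ1 : ∀ i, (𝓔 i).δ < 1) (b : Bool) {α : ℝ} (hα : 1 < α) {S : Set (Fin k → Y)}
    (hS : MeasurableSet S) :
    (A.view b).real S ≤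
      Real.exp ((α - 1) / α * (α * ∑ i, (𝓔 i).ρ + ∑ i, (𝓔 i).ξ)) *
        (A.view (!b)).real S ^ ((α - 1) / α) + ∑ i, (𝓔 i).δ := by
  have hθ : 0 < (α - 1) / α := div_pos (sub_pos.2 hα) (one_pos.trans hα)
  have hind : Measurable (S.indicator (1 : (Fin k → Y) → ℝ≥0∞)) := measurable_one.indicator hS
  have key := A.lintegral_viewUpTo_le hδ0 hδ1 b hα k le_rfl hind hind
    -- With no index left the hypothesis is `1_S ≤ 1_S ^ θ`, where `0 ^ θ = 0` uses `θ > 0`.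
    (fun h => Set.indicator_le_self' (fun _ _ => zero_le_one) h) (fun h => by
      rw [A.remaining_eq_empty h, Finset.prod_empty, Finset.sum_empty, one_mul, add_zero]
      by_cases hh : h ∈ S <;> simp [hh, hθ])
  rw [lintegral_indicator_one hS, lintegral_indicator_one hS,
    ← ENNReal.ofReal_prod_of_nonneg (fun _ _ => (Real.exp_pos _).le), ← Real.exp_sum,
    ← ENNReal.ofReal_sum_of_nonneg (fun i _ => hδ0 i)] at key
  change (A.view b) S ≤ _ * (A.view (!b)) S ^ _ + _ at key
  rw [← Finset.mul_sum, Finset.sum_add_distrib, ← Finset.mul_sum,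
    ← ENNReal.ofReal_toReal (measure_ne_top (A.view (!b)) S),
    ENNReal.ofReal_rpow_of_nonneg ENNReal.toReal_nonneg hθ.le,
    ← ENNReal.ofReal_mul (Real.exp_pos _).le,
    ← ENNReal.ofReal_add (by positivity) (Finset.sum_nonneg fun i _ => hδ0 i)] at key
  exact ENNReal.toReal_le_of_le_ofReal
    (add_nonneg (by positivity) (Finset.sum_nonneg fun i _ => hδ0 i)) key

end Analyst

/-! ### Linearisation and choice of the order -/

/-- Young's inequality, separating the two factors of a Hölder bound. -/
theorem exp_mul_rpow_le {α c ε q : ℝ} (hα : 1 < α) (hq : 0 ≤ q) :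
    Real.exp ((α - 1) / α * c) * q ^ ((α - 1) / α) ≤
      Real.exp ε * q + α⁻¹ * Real.exp ((α - 1) * (c - ε)) := by
  have hα0 : 0 < α := one_pos.trans hα
  have hw : 0 ≤ (α - 1) / α := div_nonneg (sub_pos.2 hα).le hα0.le
  have hw1 : (α - 1) / α ≤ 1 := (div_le_one hα0).2 (sub_le_self α zero_le_one)
  have hsum : (α - 1) / α + α⁻¹ = 1 := by field_simp; ring
  have hy := Real.geom_mean_le_arith_mean2_weighted hw (inv_pos.2 hα0).le
    (mul_nonneg (Real.exp_pos ε).le hq) (Real.exp_pos ((α - 1) * (c - ε))).le hsum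
  -- The second factor is chosen so that `ε` cancels in the exponent.
  have heq : (Real.exp ε * q) ^ ((α - 1) / α) * Real.exp ((α - 1) * (c - ε)) ^ α⁻¹ =
      Real.exp ((α - 1) / α * c) * q ^ ((α - 1) / α) := by
    rw [Real.mul_rpow (Real.exp_pos ε).le hq, ← Real.exp_mul, ← Real.exp_mul, mul_right_comm,
      ← Real.exp_add]
    congr 2
    field_simp
    ring
  rw [heq] at hy
  exact hy.trans (add_le_add_left
    (mul_le_of_le_one_left (mul_nonneg (Real.exp_pos ε).le hq) hw1) _)

/-- The optimal choice of the order `α`. -/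
theorem exists_exp_mul_rpow_le {r ξ δ q : ℝ} (hr : 0 ≤ r) (hδ0 : 0 < δ) (hδ1 : δ < 1)
    (hq : 0 ≤ q) :
    ∃ α : ℝ, 1 < α ∧ Real.exp ((α - 1) / α * (α * r + ξ)) * q ^ ((α - 1) / α) ≤
      Real.exp (ξ + r + 2 * Real.sqrt (r * Real.log (1 / δ))) * q + δ := by
  rcases hr.eq_or_lt with rfl | hr
  -- Here `c = ε = ξ`, so the error term is just `α⁻¹`.
  · refine ⟨δ⁻¹, (one_lt_inv₀ hδ0).2 hδ1, ?_⟩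
    refine (exp_mul_rpow_le (ε := ξ) ((one_lt_inv₀ hδ0).2 hδ1) hq).trans (le_of_eq ?_)
    simp
  · set L := Real.log (1 / δ) with hL
    have hL0 : 0 < L := Real.log_pos (by rw [one_div]; exact (one_lt_inv₀ hδ0).2 hδ1)
    -- With `t = α - 1` the exponent is `t² r - 2 t √(r L)`, minimal at `t = √L / √r` with value `-L
    -- = log δ`.
    have ht : 0 < Real.sqrt L / Real.sqrt r := div_pos (Real.sqrt_pos.2 hL0) (Real.sqrt_pos.2 hr)
    have hα : 1 < 1 + Real.sqrt L / Real.sqrt r := lt_add_of_pos_right 1 ht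
    refine ⟨_, hα, (exp_mul_rpow_le (ε := ξ + r + 2 * Real.sqrt (r * L)) hα hq).trans ?_⟩
    have hexp : (1 + Real.sqrt L / Real.sqrt r - 1) * ((1 + Real.sqrt L / Real.sqrt r) * r + ξ -
        (ξ + r + 2 * Real.sqrt (r * L))) = Real.log δ := by
      have hlog : Real.log δ = -(Real.sqrt L) ^ 2 := by
        rw [Real.sq_sqrt hL0.le, hL, one_div, Real.log_inv, neg_neg]
      have hr' : Real.sqrt r ≠ 0 := (Real.sqrt_pos.2 hr).ne'
      rw [hlog, Real.sqrt_mul hr.le]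
      nth_rewrite 3 [← Real.sq_sqrt hr.le]
      nth_rewrite 4 [← Real.sq_sqrt hr.le]
      field_simp
      ring
    rw [hexp, Real.exp_log hδ0]
    exact add_le_add_right (mul_le_of_le_one_left hδ0.le (inv_le_one_of_one_le₀ hα.le)) _

end SetwiseComposition

theorem mainTheorem6 {X : Type u} (Neighbor : X → X → Prop) (Y : Type v) [MeasurableSpace Y]
    {k : ℕ} (𝓔 : Fin k → SetwiseComposition.ZCDPParam)
    (hδ : ∀ i, 0 ≤ (𝓔 i).δ) (hρ : ∀ i, 0 ≤ (𝓔 i).ρ) (δ : ℝ) (hδ_pos : 0 < δ) :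
    SetwiseComposition.IsSetwiseAdaptiveDP Neighbor Y 𝓔
      (∑ i, ((𝓔 i).ξ + (𝓔 i).ρ) + 2 * Real.sqrt (∑ i, (𝓔 i).ρ * Real.log (1 / δ)))
      (δ + ∑ i, (𝓔 i).δ) := by
  intro A b S hS
  have hq : 0 ≤ (A.view (!b)).real S := measureReal_nonneg
  have hsum : 0 ≤ ∑ i, (𝓔 i).δ := Finset.sum_nonneg fun i _ => hδ i
  -- If the additive error is at least `1` the bound is trivial. Otherwise `δ` and all `δ_i` are
  -- below `1`, so the conditioning events are not null and `log (1 / δ) > 0`.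
  by_cases htriv : 1 ≤ δ + ∑ i, (𝓔 i).δ
  · have hp : (A.view b).real S ≤ 1 := measureReal_le_one
    exact hp.trans (htriv.trans (le_add_of_nonneg_left (mul_nonneg (Real.exp_pos _).le hq)))
  · have hδ1 : ∀ i, (𝓔 i).δ < 1 := fun i => by
      have := Finset.single_le_sum (fun j _ => hδ j) (Finset.mem_univ i)
      linarith
    obtain ⟨α, hα, hbound⟩ := SetwiseComposition.exists_exp_mul_rpow_le (ξ := ∑ i, (𝓔 i).ξ)
      (Finset.sum_nonneg fun i _ => hρ i) hδ_pos (by linarith) hq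
    have hview := A.view_real_le hδ hδ1 b hα hS
    rw [Finset.sum_add_distrib, ← Finset.sum_mul]
    linarith
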